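/- Let $N\ge 1$ be an integer and let $u\in\mathbb C$ with $u\neq 0$ and $\operatorname{Re}u<1$. For the Laguerre ensemble, write $$\langle F\rangle=\frac1{\mathcal Z}\int_{[0,\infty)^N}F(\lambda)\,e^{-N\sum_{i=1}^N\lambda_i}\,\Delta(\lambda)^2\,d\lambda_1\cdots d\lambda_N,\qquad \Delta(\lambda)=\prod_{i<j}(\lambda_i-\lambda_j),$$ where $\mathcal Z$ is the normalization constant with $\langle 1\rangle=1$, and $\mathrm{tr}\,e^{cH}=\sum_{i=1}^N e^{c\lambda_i}$. Then $0<\mathcal Z<\infty$, the integral defining $\langle\mathrm{tr}\,e^{NuH}\rangle$ converges absolutely, and $$\bigl\langle \mathrm{tr}\, e^{NuH}\bigr\rangle=\frac1u\,\frac1{2\pi i}\oint_{C_0}\frac{(1-z)^N}{(1-z-u)^N}\,\frac{(z+u)^N}{z^N}\,dz=\frac1u\,\frac1{2\pi i}\oint_{C_0}\Bigl(1+\frac1{z+u-1}\Bigr)^N\Bigl(1-\frac1z\Bigr)^N dz=\frac1u f_{N,N}(u).$$ Here $C_0$ is any piecewise $C^1$ closed curve in $\mathbb C\setminus\{0,1-u\}$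 of finite length with winding number $1$ about $0$ and winding number $0$ about $1-u$, and, for integers $A,B\ge0$, $f_{A,B}(u)=\frac1{2\pi i}\oint_{|z|=|1-u|/2}\bigl(1+\frac1{z+u-1}\bigr)^A\bigl(1-\frac1z\bigr)^B dz$, the circle being taken counterclockwise. -/

import Mathlib

open MeasureTheory

noncomputable section

namespace Laguerre

/-- The Vandermonde product `Δ(lam) = ∏_{i<j} (lam_i - lam_j)`. -/
def vandermonde {N : ℕ} (lam : Fin N → ℝ) : ℝ :=
  ∏ i : Fin N, ∏ j ∈ Finset.Ioi i, (lam i - lam j)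

/-- The unnormalised joint eigenvalue density `e^{-N ∑ lam_i} Δ(lam)²`. -/
def weight (N : ℕ) (lam : Fin N → ℝ) : ℝ :=
  Real.exp (-(N : ℝ) * ∑ i, lam i) * vandermonde lam ^ 2

/-- The domain of integration `[0, ∞)^N`. -/
def orthant (N : ℕ) : Set (Fin N → ℝ) := {lam | ∀ i, 0 ≤ lam i}

/-- The normalisation constant `Z` (for which the mean of `1` is `1`). -/
def partitionFunction (N : ℕ) : ℝ := ∫ lam in orthant N, weight N lam

/-- The mean `⟨F⟩` of an eigenvalue statistic `F` over the Laguerre ensemble of size `N`. -/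
def mean (N : ℕ) (F : (Fin N → ℝ) → ℂ) : ℂ :=
  ((partitionFunction N : ℝ) : ℂ)⁻¹ * ∫ lam in orthant N, (weight N lam : ℂ) * F lam

/-- `tr e^{cH} = ∑_i e^{c lam_i}`, as a function of the eigenvalues `lam_i` of `H`. -/
def traceExp {N : ℕ} (c : ℂ) (lam : Fin N → ℝ) : ℂ :=
  ∑ i, Complex.exp (c * (lam i : ℂ))

/-- The contour integral `∮_γ g(z) dz` along a closed curve. -/
def contourIntegral {a : ℂ} (γ : Path a a) (g : ℂ → ℂ) : ℂ :=
  curveIntegral (fun z : ℂ => ContinuousLinearMap.toSpanSingleton ℂ (g z)) γ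

/-- The winding number of a closed curve about a point `w` off the curve. -/
def windingNumber {a : ℂ} (γ : Path a a) (w : ℂ) : ℂ :=
  (2 * Real.pi * Complex.I)⁻¹ * contourIntegral γ (fun z => (z - w)⁻¹)

/-- The curve is `C¹` away from finitely many parameters and has finite length. -/
def IsPiecewiseC1 {a : ℂ} (γ : Path a a) : Prop :=
  (∃ S : Finset ℝ, ∀ t ∈ Set.Ioo (0 : ℝ) 1, t ∉ S → ContDiffAt ℝ 1 γ.extend t) ∧
    IntervalIntegrable (deriv γ.extend) volume 0 1

/-- An admissible contour `C₀` for the parameter `u`: a piecewise `C¹` closed curve that goes once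
counterclockwise round the pole `z = 0` and does not encircle the pole `z = 1 - u`. -/
structure IsContour (u : ℂ) {a : ℂ} (γ : Path a a) : Prop where
  piecewiseC1 : IsPiecewiseC1 γ
  avoids_zero : ∀ t, γ t ≠ 0
  avoids_pole : ∀ t, γ t ≠ 1 - u
  winding_zero : windingNumber γ 0 = 1
  winding_pole : windingNumber γ (1 - u) = 0

/-- `f_{A,B}(u) = (1 / 2πi) ∮ (1 + 1/(z+u-1))^A (1 - 1/z)^B dz`, over the counterclockwise circle
about `0` of radius `|1-u|/2` (which has `0` inside and `1 - u` outside when `u ≠ 1`). -/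
def f (A B : ℕ) (u : ℂ) : ℂ :=
  (2 * Real.pi * Complex.I)⁻¹ *
    ∮ z in C(0, ‖1 - u‖ / 2), (1 + 1 / (z + u - 1)) ^ A * (1 - 1 / z) ^ B

end Laguerre

end

/-! Both sides equal the same finite sum. Put `s = 1 - u`; the common value is the sum over `k < N`
of `laplaceCoeff s k k`, the Laplace transforms at `s` of the squared Laguerre polynomials.

Ensemble side: column operations turn the weight into a product of two determinants of Laguerre
functions. Andréief's expansion over pairs of permutations, with orthogonality, leaves only the
diagonal one-particle integrals (`mean_traceExp`).

Contour side: with `p = (1 - 1/z) (1 - 1/(s - z))` one has `p - 1 = (1 - s) / (z (s - z))`, so `p ^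
N` is `1` plus `u` times a geometric sum of the kernels `p ^ k / (z (s - z))`
(`eq_sum_laplaceCoeff`). Partial fractions give `z⁻¹ ^ (i+1) * (s - z)⁻¹ ^ (j+1)` the residue
`(i+j).choose i / s ^ (i+j+1)`, which is also the Laplace transform of `x ^ (i+j) / (i! j!)`; hence
each kernel integrates to `laplaceCoeff s k k`.

Only six formal properties of the contour integral are needed (`IsResidueFunctional`), so arbitrary
admissible curves and the circle defining `f` are handled together, without the residue theorem.
Orthogonality itself is the case `s = 1`. -/

namespace Laguerre

/-! ### Residue calculus for two poles -/

/-- The properties of a normalised contour integral about the pole `0` of functions that are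
continuous off `0` and `s`: it is linear, vanishes on derivatives, has value `1` on `z⁻¹` and
value `0` on `(s - z)⁻¹`. -/
structure IsResidueFunctional (s : ℂ) (I : (ℂ → ℂ) → ℂ) : Prop where
  add : ∀ g h : ℂ → ℂ, ContinuousOn g {0, s}ᶜ → ContinuousOn h {0, s}ᶜ →
    I (fun z => g z + h z) = I g + I h
  smul : ∀ (c : ℂ) (g : ℂ → ℂ), ContinuousOn g {0, s}ᶜ → I (fun z => c * g z) = c * I g
  congr : ∀ g h : ℂ → ℂ, Set.EqOn g h {0, s}ᶜ → I g = I h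
  deriv : ∀ g h : ℂ → ℂ, ContinuousOn h {0, s}ᶜ → (∀ z ∈ ({0, s}ᶜ : Set ℂ), HasDerivAt g (h z) z) →
    I h = 0
  inv : I (fun z => z⁻¹) = 1
  inv_sub : I (fun z => (s - z)⁻¹) = 0

theorem mem_compl_pair {s z : ℂ} : z ∈ ({0, s}ᶜ : Set ℂ) ↔ z ≠ 0 ∧ s - z ≠ 0 := by
  simp [sub_eq_zero, eq_comm (a := s)]

theorem continuousOn_inv_compl_pair (s : ℂ) :
    ContinuousOn (fun z : ℂ => z⁻¹) ({0, s}ᶜ : Set ℂ) :=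
  continuousOn_id.inv₀ fun _ hz => (mem_compl_pair.1 hz).1

theorem continuousOn_inv_sub_compl_pair (s : ℂ) :
    ContinuousOn (fun z : ℂ => (s - z)⁻¹) ({0, s}ᶜ : Set ℂ) :=
  (continuousOn_const.sub continuousOn_id).inv₀ fun _ hz => (mem_compl_pair.1 hz).2

theorem continuousOn_inv_pow_mul_inv_sub_pow (s : ℂ) (i j : ℕ) :
    ContinuousOn (fun z : ℂ => z⁻¹ ^ i * (s - z)⁻¹ ^ j) ({0, s}ᶜ : Set ℂ) :=
  ((continuousOn_inv_compl_pair s).pow i).mul ((continuousOn_inv_sub_compl_pair s).pow j)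

/-- The Laplace transform at `s` of the product of the Laguerre polynomials of degrees `k`, `l`. -/
noncomputable def laplaceCoeff (s : ℂ) (k l : ℕ) : ℂ :=
  ∑ i ∈ Finset.range (k + 1), ∑ j ∈ Finset.range (l + 1),
    (-1) ^ i * k.choose i * ((-1) ^ j * l.choose j) * ((i + j).choose i / s ^ (i + j + 1))

namespace IsResidueFunctional

variable {s : ℂ} {I : (ℂ → ℂ) → ℂ}

theorem zero (hI : IsResidueFunctional s I) : I (fun _ => 0) = 0 := by
  simpa using hI.smul 0 (fun _ => 0) continuousOn_const

theorem one (hI : IsResidueFunctional s I) : I (fun _ => 1) = 0 :=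
  hI.deriv id _ continuousOn_const fun z _ => hasDerivAt_id z

theorem sum (hI : IsResidueFunctional s I) {ι : Type*} (t : Finset ι) (g : ι → ℂ → ℂ)
    (hg : ∀ i ∈ t, ContinuousOn (g i) {0, s}ᶜ) :
    I (fun z => ∑ i ∈ t, g i z) = ∑ i ∈ t, I (g i) := by
  classical
  induction t using Finset.induction_on with
  | empty => simpa using hI.zero
  | insert a t ha ih =>
    simp only [Finset.sum_insert ha]
    rw [hI.add _ _ (hg a (by simp)) (continuousOn_finsetSum t fun i hi => hg i (by simp [hi])),
      ih fun i hi => hg i (by simp [hi])]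

theorem map_inv_pow (hI : IsResidueFunctional s I) (n : ℕ) : I (fun z => z⁻¹ ^ (n + 2)) = 0 := by
  have hn : (n : ℂ) + 1 ≠ 0 := by exact_mod_cast n.succ_ne_zero
  refine hI.deriv (fun z => -((n : ℂ) + 1)⁻¹ * z⁻¹ ^ (n + 1)) _
    ((continuousOn_inv_compl_pair s).pow _) fun z hz => ?_
  have hz := (mem_compl_pair.1 hz).1
  refine (((hasDerivAt_inv hz).fun_pow (n + 1)).const_mul (-((n : ℂ) + 1)⁻¹)).congr_deriv ?_
  push_cast
  simp only [inv_pow]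
  field_simp
  ring

theorem inv_sub_pow (hI : IsResidueFunctional s I) (n : ℕ) :
    I (fun z => (s - z)⁻¹ ^ (n + 1)) = 0 := by
  rcases n with _ | n
  · simpa using hI.inv_sub
  have hn : (n : ℂ) + 1 ≠ 0 := by exact_mod_cast n.succ_ne_zero
  refine hI.deriv (fun z => ((n : ℂ) + 1)⁻¹ * (s - z)⁻¹ ^ (n + 1)) _
    ((continuousOn_inv_sub_compl_pair s).pow _) fun z hz => ?_
  have hz := (mem_compl_pair.1 hz).2
  refine (((((hasDerivAt_id' z).const_sub s).fun_inv hz).fun_pow (n + 1)).const_mul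
    (((n : ℂ) + 1)⁻¹)).congr_deriv ?_
  push_cast
  simp only [inv_pow]
  field_simp
  ring

theorem inv_mul_inv_sub (hs : s ≠ 0) {z : ℂ} (hz : z ∈ ({0, s}ᶜ : Set ℂ)) :
    z⁻¹ * (s - z)⁻¹ = s⁻¹ * (z⁻¹ + (s - z)⁻¹) := by
  obtain ⟨h0, h1⟩ := mem_compl_pair.1 hz
  field_simp
  ring

/-- Splitting one factor `z⁻¹ * (s - z)⁻¹` into partial fractions lowers one exponent at a time; up
to powers of `s` this is Pascal's rule. -/
theorem inv_pow_mul_inv_sub_pow_rec (hI : IsResidueFunctional s I) (hs : s ≠ 0) (i j : ℕ) :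
    I (fun z => z⁻¹ ^ (i + 1) * (s - z)⁻¹ ^ (j + 1)) =
      s⁻¹ * (I (fun z => z⁻¹ ^ (i + 1) * (s - z)⁻¹ ^ j) +
        I (fun z => z⁻¹ ^ i * (s - z)⁻¹ ^ (j + 1))) := by
  have hc := continuousOn_inv_pow_mul_inv_sub_pow s
  rw [← hI.add _ _ (hc _ _) (hc _ _), ← hI.smul _ _ ((hc _ _).fun_add (hc _ _))]
  refine hI.congr _ _ fun z hz => ?_
  have h := inv_mul_inv_sub hs hz
  calc z⁻¹ ^ (i + 1) * (s - z)⁻¹ ^ (j + 1)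
      = z⁻¹ ^ i * (s - z)⁻¹ ^ j * (z⁻¹ * (s - z)⁻¹) := by ring
    _ = _ := by rw [h]; ring

theorem inv_pow_mul_inv_sub_pow (hI : IsResidueFunctional s I) (hs : s ≠ 0) (i j : ℕ) :
    I (fun z => z⁻¹ ^ (i + 1) * (s - z)⁻¹ ^ (j + 1)) = (i + j).choose i / s ^ (i + j + 1) := by
  induction h : i + j generalizing i j with
  | zero =>
    obtain ⟨rfl, rfl⟩ : i = 0 ∧ j = 0 := by omega
    rw [hI.inv_pow_mul_inv_sub_pow_rec hs]
    have h1 := hI.inv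
    have h2 := hI.inv_sub
    simp [h1, h2]
  | succ n ih =>
    rw [hI.inv_pow_mul_inv_sub_pow_rec hs]
    -- On the boundary of the triangle one of the two terms is a pure power with residue `0`, by a
    -- primitive or by `inv_sub`.
    rcases i with _ | i
    · obtain rfl : j = n + 1 := by omega
      rw [ih 0 n (by omega)]
      have h2 := hI.inv_sub_pow (n + 1)
      simp only [pow_zero, one_mul, h2]
      simp only [Nat.choose_zero_right, Nat.cast_one]
      field_simp
      simp [pow_succ']
    · rcases j with _ | j
      · obtain rfl : i = n := by omega
        rw [ih i 0 (by omega)]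
        have h2 := hI.map_inv_pow i
        simp only [pow_zero, mul_one, h2]
        simp only [Nat.choose_self, Nat.cast_one]
        field_simp
        simp [pow_succ']
      · rw [ih (i + 1) j (by omega), ih i (j + 1) (by omega), Nat.choose_succ_succ]
        push_cast
        field_simp
        ring

theorem one_sub_pow_eq_sum (w : ℂ) (k : ℕ) :
    (1 - w) ^ k = ∑ i ∈ Finset.range (k + 1), (-1) ^ i * k.choose i * w ^ i := by
  rw [sub_eq_add_neg, add_comm, add_pow]
  refine Finset.sum_congr rfl fun i _ => ?_
  rw [neg_pow]
  ring

theorem eq_laplaceCoeff (hI : IsResidueFunctional s I) (hs : s ≠ 0) (k l : ℕ) :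
    I (fun z => z⁻¹ * (s - z)⁻¹ * ((1 - z⁻¹) ^ k * (1 - (s - z)⁻¹) ^ l)) = laplaceCoeff s k l := by
  have hc := continuousOn_inv_pow_mul_inv_sub_pow s
  have hexp : ∀ z : ℂ, z⁻¹ * (s - z)⁻¹ * ((1 - z⁻¹) ^ k * (1 - (s - z)⁻¹) ^ l) =
      ∑ i ∈ Finset.range (k + 1), ∑ j ∈ Finset.range (l + 1),
        (-1) ^ i * k.choose i * ((-1) ^ j * l.choose j) *
          (z⁻¹ ^ (i + 1) * (s - z)⁻¹ ^ (j + 1)) := by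
    intro z
    rw [one_sub_pow_eq_sum, one_sub_pow_eq_sum, Finset.sum_mul_sum, Finset.mul_sum]
    refine Finset.sum_congr rfl fun i _ => ?_
    rw [Finset.mul_sum]
    exact Finset.sum_congr rfl fun j _ => by ring
  simp only [hexp]
  rw [hI.sum _ _ fun i _ => continuousOn_finsetSum _ fun j _ => continuousOn_const.fun_mul (hc _ _)]
  refine Finset.sum_congr rfl fun i _ => ?_
  rw [hI.sum _ _ fun j _ => continuousOn_const.fun_mul (hc _ _)]
  refine Finset.sum_congr rfl fun j _ => ?_
  rw [hI.smul _ _ (hc _ _), hI.inv_pow_mul_inv_sub_pow hs]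

theorem continuousOn_kernel (s : ℂ) (k l : ℕ) :
    ContinuousOn (fun z => z⁻¹ * (s - z)⁻¹ * ((1 - z⁻¹) ^ k * (1 - (s - z)⁻¹) ^ l))
      ({0, s}ᶜ : Set ℂ) := by
  have h1 := continuousOn_inv_compl_pair s
  have h2 := continuousOn_inv_sub_compl_pair s
  fun_prop

theorem eq_sum_laplaceCoeff (hI : IsResidueFunctional s I) (hs : s ≠ 0) (N : ℕ) :
    I (fun z => (1 - z⁻¹) ^ N * (1 - (s - z)⁻¹) ^ N) =
      (1 - s) * ∑ k ∈ Finset.range N, laplaceCoeff s k k := by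
  have h : I (fun z => (1 - z⁻¹) ^ N * (1 - (s - z)⁻¹) ^ N) =
      I (fun z => 1 + (1 - s) * ∑ k ∈ Finset.range N,
        z⁻¹ * (s - z)⁻¹ * ((1 - z⁻¹) ^ k * (1 - (s - z)⁻¹) ^ k)) := by
    refine hI.congr _ _ fun z hz => ?_
    have h := inv_mul_inv_sub hs hz
    -- The deviation of the ratio from `1` is `1 - s` times the kernel, so the geometric sum
    -- telescopes.
    have hq : (1 - z⁻¹) * (1 - (s - z)⁻¹) - 1 = (1 - s) * (z⁻¹ * (s - z)⁻¹) := by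
      linear_combination s * h + (z⁻¹ + (s - z)⁻¹) * mul_inv_cancel₀ hs
    simp only [← mul_pow, ← Finset.mul_sum]
    rw [← mul_assoc, ← hq, mul_geom_sum]
    ring
  have hc : ContinuousOn (fun z => ∑ k ∈ Finset.range N,
      z⁻¹ * (s - z)⁻¹ * ((1 - z⁻¹) ^ k * (1 - (s - z)⁻¹) ^ k)) ({0, s}ᶜ : Set ℂ) :=
    continuousOn_finsetSum _ fun k _ => continuousOn_kernel s k k
  rw [h, hI.add _ _ continuousOn_const (continuousOn_const.fun_mul hc), hI.one, zero_add,
    hI.smul _ _ hc, hI.sum _ _ fun k _ => continuousOn_kernel s k k]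
  simp only [hI.eq_laplaceCoeff hs]

end IsResidueFunctional

theorem laplaceCoeff_comm (s : ℂ) (k l : ℕ) : laplaceCoeff s k l = laplaceCoeff s l k := by
  rw [laplaceCoeff, laplaceCoeff, Finset.sum_comm]
  refine Finset.sum_congr rfl fun j _ => Finset.sum_congr rfl fun i _ => ?_
  rw [add_comm j i, ← Nat.choose_symm_add]
  ring

/-- Orthonormality of the Laguerre polynomials: at `s = 1` the factors `1 - z⁻¹` and `1 - (1 - z)⁻¹`
are mutually inverse, so only their exponent difference matters. -/
theorem IsResidueFunctional.laplaceCoeff_one {I : (ℂ → ℂ) → ℂ} (hI : IsResidueFunctional 1 I)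
    (k l : ℕ) : laplaceCoeff 1 k l = if k = l then 1 else 0 := by
  wlog hkl : l ≤ k generalizing k l
  · rw [laplaceCoeff_comm, this l k (by omega)]
    simp [eq_comm]
  obtain ⟨m, rfl⟩ := Nat.exists_eq_add_of_le hkl
  have h1 := continuousOn_inv_compl_pair 1
  have h2 := continuousOn_inv_sub_compl_pair 1
  rw [← hI.eq_laplaceCoeff one_ne_zero]
  have hq : ∀ z ∈ ({0, 1}ᶜ : Set ℂ), (1 - z⁻¹) * (1 - (1 - z)⁻¹) = 1 := fun z hz => by
    linear_combination inv_mul_inv_sub one_ne_zero hz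
  rcases m with _ | m
  · rw [if_pos (by simp), hI.congr _ (fun z => z⁻¹ + (1 - z)⁻¹), hI.add _ _ h1 h2, hI.inv,
      hI.inv_sub, add_zero]
    intro z hz
    simp only [add_zero, ← mul_pow]
    rw [hq z hz, inv_mul_inv_sub one_ne_zero hz]
    simp
  -- Since `(1 - z)⁻¹ * (1 - z⁻¹) = -z⁻¹`, the kernel collapses to `-z⁻¹ ^ 2 * (1 - z⁻¹) ^ m`, a
  -- combination of powers `z⁻¹ ^ (i + 2)`, all of which have primitives.
  · rw [if_neg (by omega), hI.congr _ (fun z => ∑ i ∈ Finset.range (m + 1),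
      -1 * ((-1) ^ i * m.choose i) * z⁻¹ ^ (i + 2))]
    · rw [hI.sum _ _ fun i _ => continuousOn_const.fun_mul (h1.fun_pow _)]
      refine Finset.sum_eq_zero fun i _ => ?_
      rw [hI.smul _ _ (h1.fun_pow _), hI.map_inv_pow, mul_zero]
    · intro z hz
      have h3 : z⁻¹ * (1 - z)⁻¹ = z⁻¹ + (1 - z)⁻¹ := by
        simpa using inv_mul_inv_sub one_ne_zero hz
      calc z⁻¹ * (1 - z)⁻¹ * ((1 - z⁻¹) ^ (l + (m + 1)) * (1 - (1 - z)⁻¹) ^ l)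
          = z⁻¹ * ((1 - z)⁻¹ * (1 - z⁻¹)) * (1 - z⁻¹) ^ m *
              ((1 - z⁻¹) * (1 - (1 - z)⁻¹)) ^ l := by
            rw [mul_pow (1 - z⁻¹)]; ring
        _ = -1 * z⁻¹ ^ 2 * (1 - z⁻¹) ^ m := by
            rw [hq z hz, one_pow, mul_one]
            linear_combination -z⁻¹ * (1 - z⁻¹) ^ m * h3
        _ = _ := by
            rw [one_sub_pow_eq_sum, Finset.mul_sum]
            exact Finset.sum_congr rfl fun i _ => by ring

/-! ### Contour integrals as residue functionals -/

section PiecewiseC1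

variable {a : ℂ} {γ : Path a a}

theorem contourIntegral_eq_intervalIntegral (γ : Path a a) (g : ℂ → ℂ) :
    contourIntegral γ g = ∫ t in (0 : ℝ)..1, deriv γ.extend t * g (γ.extend t) := by
  rw [contourIntegral, curveIntegral_eq_intervalIntegral_deriv]
  simp

theorem IsPiecewiseC1.intervalIntegrable (hγ : IsPiecewiseC1 γ) {U : Set ℂ} (hU : ∀ t, γ t ∈ U)
    {g : ℂ → ℂ} (hg : ContinuousOn g U) :
    IntervalIntegrable (fun t => deriv γ.extend t * g (γ.extend t)) volume 0 1 :=
  hγ.2.mul_continuousOn <|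
    hg.comp γ.continuous_extend.continuousOn fun _ _ => hU _

/-- The fundamental theorem of calculus along the curve, off the finite exceptional set; the
endpoint values cancel because the curve is closed. -/
theorem IsPiecewiseC1.contourIntegral_deriv (hγ : IsPiecewiseC1 γ) {U : Set ℂ}
    (hU : ∀ t, γ t ∈ U) {g h : ℂ → ℂ} (hh : ContinuousOn h U)
    (hd : ∀ z ∈ U, HasDerivAt g (h z) z) : contourIntegral γ h = 0 := by
  obtain ⟨S, hS⟩ := hγ.1
  have hU' : ∀ t, γ.extend t ∈ U := fun _ => hU _
  rw [contourIntegral_eq_intervalIntegral,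
    integral_eq_of_hasDerivAt_off_countable_of_le (fun t => g (γ.extend t)) _ zero_le_one
      S.countable_toSet _ _ (hγ.intervalIntegrable hU hh)]
  · simp
  · exact fun t _ => ((hd _ (hU' t)).continuousAt.comp
      γ.continuous_extend.continuousAt).continuousWithinAt
  · rintro t ⟨ht, htS⟩
    have h1 : HasDerivAt γ.extend (deriv γ.extend t) t :=
      ((hS t ht htS).differentiableAt one_ne_zero).hasDerivAt
    exact (hd _ (hU' t)).scomp t h1

end PiecewiseC1

/-- The two winding numbers supply exactly `inv` and `inv_sub`. -/
theorem IsContour.isResidueFunctional {u a : ℂ} {γ : Path a a} (hγ : IsContour u γ) :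
    IsResidueFunctional (1 - u)
      (fun g => (2 * Real.pi * Complex.I)⁻¹ * contourIntegral γ g) := by
  have hU : ∀ t, γ t ∈ ({0, 1 - u}ᶜ : Set ℂ) := fun t => by
    simp [hγ.avoids_zero t, hγ.avoids_pole t]
  have hint := fun (g : ℂ → ℂ) hg => hγ.piecewiseC1.intervalIntegrable hU (g := g) hg
  refine ⟨fun g h hg hh => ?_, fun c g _ => ?_, fun g h hgh => ?_, fun g h hh hd => ?_, ?_, ?_⟩
  · simp only [contourIntegral_eq_intervalIntegral, mul_add]
    rw [intervalIntegral.integral_add (hint g hg) (hint h hh), mul_add]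
  · simp only [contourIntegral_eq_intervalIntegral, mul_left_comm _ c]
    rw [intervalIntegral.integral_const_mul, mul_left_comm]
  · simp only [contourIntegral_eq_intervalIntegral]
    congr 2
    ext t
    rw [hgh (show γ.extend t ∈ ({0, 1 - u}ᶜ : Set ℂ) from hU _)]
  · simp only [hγ.piecewiseC1.contourIntegral_deriv hU hh hd, mul_zero]
  · simpa [windingNumber] using hγ.winding_zero
  · have h := hγ.winding_pole
    rw [windingNumber] at h
    have h2 : contourIntegral γ (fun z => (1 - u - z)⁻¹) =
        -contourIntegral γ (fun z => (z - (1 - u))⁻¹) := by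
      simp only [contourIntegral_eq_intervalIntegral, ← intervalIntegral.integral_neg]
      congr 1
      ext t
      rw [← neg_sub, inv_neg, mul_neg]
    rw [h2, mul_neg, h, neg_zero]

theorem isResidueFunctional_circleIntegral {s : ℂ} {R : ℝ} (hR : 0 < R) (hRs : R < ‖s‖) :
    IsResidueFunctional s (fun g => (2 * Real.pi * Complex.I)⁻¹ * ∮ z in C(0, R), g z) := by
  have hU : Metric.sphere (0 : ℂ) R ⊆ {0, s}ᶜ := by
    intro z hz
    have hz : ‖z‖ = R := by simpa using hz
    rintro (rfl | rfl)
    · simp [hR.ne] at hz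
    · exact hRs.ne' hz
  have hint : ∀ g : ℂ → ℂ, ContinuousOn g {0, s}ᶜ → CircleIntegrable g 0 R := fun g hg =>
    (hg.mono hU).circleIntegrable hR.le
  refine ⟨fun g h hg hh => ?_, fun c g _ => ?_, fun g h hgh => ?_, fun g h hh hd => ?_, ?_, ?_⟩
  · rw [circleIntegral.integral_add (hint g hg) (hint h hh), mul_add]
  · rw [circleIntegral.integral_const_mul, mul_left_comm]
  · rw [circleIntegral.integral_congr hR.le fun z hz => hgh (hU hz)]
  · rw [circleIntegral.integral_eq_zero_of_hasDerivWithinAt hR.le fun z hz =>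
      (hd z (hU hz)).hasDerivWithinAt, mul_zero]
  · have h := circleIntegral.integral_sub_center_inv (0 : ℂ) hR.ne'
    simp only [sub_zero] at h
    rw [h]
    exact inv_mul_cancel₀ Complex.two_pi_I_ne_zero
  · have hne : ∀ z ∈ Metric.closedBall (0 : ℂ) R, s - z ≠ 0 := fun z hz h => by
      rw [sub_eq_zero] at h
      rw [← h] at hz
      simp only [Metric.mem_closedBall, dist_zero_right] at hz
      exact absurd hz (not_le.2 hRs)
    have h : ∮ z in C(0, R), (s - z)⁻¹ = 0 :=
      Complex.circleIntegral_eq_zero_of_differentiable_on_off_countable hR.le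
        Set.countable_empty ((continuousOn_const.sub continuousOn_id).inv₀ hne)
        fun z hz => ((differentiableAt_const s).sub differentiableAt_id).inv
          (hne z (Metric.ball_subset_closedBall hz.1))
    rw [h, mul_zero]

/-- The claim concerns a finite sum, so any one residue functional with `s = 1` proves it. -/
theorem laplaceCoeff_one (k l : ℕ) : laplaceCoeff 1 k l = if k = l then 1 else 0 :=
  (isResidueFunctional_circleIntegral (s := 1) (R := 1 / 2) (by norm_num)
    (by norm_num)).laplaceCoeff_one k l

/-! ### The two integrands of the theorem -/

theorem IsResidueFunctional.eq_integrand {u : ℂ} {I : (ℂ → ℂ) → ℂ}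
    (hI : IsResidueFunctional (1 - u) I) (hu : 1 - u ≠ 0) (N : ℕ) :
    I (fun z => (1 + 1 / (z + u - 1)) ^ N * (1 - 1 / z) ^ N) =
      u * ∑ k ∈ Finset.range N, laplaceCoeff (1 - u) k k := by
  have h := hI.eq_sum_laplaceCoeff hu N
  rw [sub_sub_cancel] at h
  rw [← h]
  refine hI.congr _ _ fun z _ => ?_
  have h1 : z + u - 1 = -(1 - u - z) := by ring
  simp only [one_div, h1, inv_neg, ← sub_eq_add_neg]
  rw [mul_comm]

theorem IsResidueFunctional.eq_quotient_integrand {u : ℂ} {I : (ℂ → ℂ) → ℂ}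
    (hI : IsResidueFunctional (1 - u) I) (hu : 1 - u ≠ 0) (N : ℕ) :
    I (fun z => (1 - z) ^ N / (1 - z - u) ^ N * ((z + u) ^ N / z ^ N)) =
      u * ∑ k ∈ Finset.range N, laplaceCoeff (1 - u) k k := by
  rw [← hI.eq_integrand hu]
  refine hI.congr _ _ fun z hz => ?_
  obtain ⟨h0, h1⟩ := mem_compl_pair.1 hz
  have h2 : 1 - z - u ≠ 0 := by rwa [sub_right_comm]
  have h3 : z + u - 1 ≠ 0 := by
    rw [← neg_ne_zero]; convert h1 using 1; ring
  simp only [← div_pow, ← mul_pow]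
  congr 1
  have h4 : z + u - 1 = -(1 - z - u) := by ring
  rw [h4]
  field_simp
  ring

/-! ### Laplace transforms of Laguerre polynomials -/

open Filter Topology in
theorem tendsto_pow_mul_cexp_neg_atTop (n : ℕ) {c : ℂ} (hc : 0 < c.re) :
    Tendsto (fun x : ℝ => (x : ℂ) ^ n * Complex.exp (-c * x)) atTop (𝓝 0) := by
  rw [tendsto_zero_iff_norm_tendsto_zero]
  refine (tendsto_rpow_mul_exp_neg_mul_atTop_nhds_zero n c.re hc).congr' ?_
  filter_upwards [eventually_ge_atTop 0] with x hx
  simp [Complex.norm_exp, abs_of_nonneg hx]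

theorem integrableOn_pow_mul_cexp_neg (n : ℕ) {c : ℂ} (hc : 0 < c.re) :
    IntegrableOn (fun x : ℝ => (x : ℂ) ^ n * Complex.exp (-c * x)) (Set.Ioi 0) := by
  have h := integrableOn_rpow_mul_exp_neg_mul_rpow (s := n) (p := 1)
    (by exact_mod_cast neg_one_lt_zero.trans_le n.cast_nonneg) one_pos hc
  refine h.mono' (by fun_prop) ?_
  filter_upwards [ae_restrict_mem measurableSet_Ioi] with x hx
  simp [Complex.norm_exp, abs_of_nonneg (Set.mem_Ioi.1 hx).le]

/-- Integration by parts on the real half-line handles complex `c` directly: the derivative of `x ^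
(n + 1) * exp (-c x)` has integral `0`. -/
theorem integral_pow_mul_cexp_neg (n : ℕ) {c : ℂ} (hc : 0 < c.re) :
    ∫ x in Set.Ioi (0 : ℝ), (x : ℂ) ^ n * Complex.exp (-c * x) = n.factorial / c ^ (n + 1) := by
  have hc0 : c ≠ 0 := by rintro rfl; simp at hc
  have hd : ∀ x : ℝ, HasDerivAt (fun x : ℝ => Complex.exp (-c * x))
      (Complex.exp (-c * x) * (-c)) x := fun x => by
    simpa using ((Complex.ofRealCLM.hasDerivAt (x := x)).const_mul (-c)).cexp
  induction n with
  | zero =>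
    have h := integral_Ioi_of_hasDerivAt_of_tendsto' (a := 0) (fun x _ => hd x)
      (by simpa [IntegrableOn] using (integrableOn_pow_mul_cexp_neg 0 hc).mul_const (-c))
      (by simpa using tendsto_pow_mul_cexp_neg_atTop 0 hc)
    rw [integral_mul_const] at h
    simp only [pow_zero, one_mul, Nat.factorial_zero, Nat.cast_one, zero_add, pow_one]
    rw [eq_div_iff hc0]
    simp only [Complex.ofReal_zero, mul_zero, Complex.exp_zero] at h
    linear_combination -h
  | succ n ih =>
    have hi1 := (integrableOn_pow_mul_cexp_neg n hc).const_mul ((n : ℂ) + 1)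
    have hi2 := (integrableOn_pow_mul_cexp_neg (n + 1) hc).mul_const (-c)
    have hd2 : ∀ x : ℝ, HasDerivAt (fun x : ℝ => (x : ℂ) ^ (n + 1) * Complex.exp (-c * x))
        (((n : ℂ) + 1) * ((x : ℂ) ^ n * Complex.exp (-c * x)) +
          (x : ℂ) ^ (n + 1) * Complex.exp (-c * x) * (-c)) x := fun x => by
      refine (((Complex.ofRealCLM.hasDerivAt (x := x)).fun_pow (n + 1)).mul (hd x)).congr_deriv ?_
      simp
      ring
    have h := integral_Ioi_of_hasDerivAt_of_tendsto' (a := 0) (fun x _ => hd2 x)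
      (hi1.add hi2) (tendsto_pow_mul_cexp_neg_atTop (n + 1) hc)
    rw [integral_add hi1 hi2, integral_mul_const, integral_const_mul, ih] at h
    rw [Nat.factorial_succ]
    have hp : c ^ (n + 1) ≠ 0 := pow_ne_zero _ hc0
    rw [eq_div_iff (pow_ne_zero _ hc0)]
    simp only [Complex.ofReal_zero, ne_eq, Nat.succ_ne_zero, not_false_eq_true, zero_pow, zero_mul,
      sub_zero] at h
    have h3 : (n.factorial : ℂ) / c ^ (n + 1) * c ^ (n + 1) = n.factorial := div_mul_cancel₀ _ hp
    push_cast
    linear_combination -c ^ (n + 1) * h + ((n : ℂ) + 1) * h3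

open Polynomial in
/-- The Laguerre polynomial `L_k (r x)`, as a polynomial in `x`. -/
noncomputable def scaledLaguerre (r : ℝ) (k : ℕ) : ℝ[X] :=
  ∑ i ∈ Finset.range (k + 1), C ((-1) ^ i * k.choose i * (r ^ i / i.factorial)) * X ^ i

theorem natDegree_scaledLaguerre_le (r : ℝ) (k : ℕ) : (scaledLaguerre r k).natDegree ≤ k :=
  Polynomial.natDegree_sum_le_of_forall_le _ _ fun i hi =>
    (Polynomial.natDegree_C_mul_X_pow_le _ _).trans (by simpa [Nat.lt_succ_iff] using hi)

theorem coeff_scaledLaguerre_ne_zero {r : ℝ} (hr : r ≠ 0) (k : ℕ) :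
    (scaledLaguerre r k).coeff k ≠ 0 := by
  have h : (scaledLaguerre r k).coeff k = (-1) ^ k * (r ^ k / k.factorial) := by
    simp only [scaledLaguerre, Polynomial.finsetSum_coeff, Polynomial.coeff_C_mul,
      Polynomial.coeff_X_pow]
    simp
  rw [h]
  have := k.factorial_ne_zero
  positivity

theorem ofReal_eval_scaledLaguerre (r : ℝ) (k : ℕ) (x : ℝ) :
    (((scaledLaguerre r k).eval x : ℝ) : ℂ) =
      ∑ i ∈ Finset.range (k + 1), (-1) ^ i * k.choose i * ((r : ℂ) ^ i / i.factorial) * x ^ i := by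
  simp [scaledLaguerre, Polynomial.eval_finsetSum]

section

variable {r : ℝ} {s : ℂ}

theorem scaledLaguerre_mul_scaledLaguerre_mul_cexp (r : ℝ) (s : ℂ) (k l : ℕ) (x : ℝ) :
    (((scaledLaguerre r k).eval x : ℝ) : ℂ) * ((scaledLaguerre r l).eval x : ℝ) *
        Complex.exp (-(r * s) * x) =
      ∑ i ∈ Finset.range (k + 1), ∑ j ∈ Finset.range (l + 1),
        ((-1) ^ i * k.choose i * ((r : ℂ) ^ i / i.factorial)) *
          ((-1) ^ j * l.choose j * ((r : ℂ) ^ j / j.factorial)) *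
            ((x : ℂ) ^ (i + j) * Complex.exp (-(r * s) * x)) := by
  rw [ofReal_eval_scaledLaguerre, ofReal_eval_scaledLaguerre, Finset.sum_mul_sum, Finset.sum_mul]
  refine Finset.sum_congr rfl fun i _ => ?_
  rw [Finset.sum_mul]
  exact Finset.sum_congr rfl fun j _ => by ring

theorem integrableOn_scaledLaguerre_mul_cexp (hr : 0 < r) (hs : 0 < s.re) (k l : ℕ) :
    IntegrableOn (fun x : ℝ => (((scaledLaguerre r k).eval x : ℝ) : ℂ) *
      ((scaledLaguerre r l).eval x : ℝ) * Complex.exp (-(r * s) * x)) (Set.Ici 0) := by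
  have hc : 0 < ((r : ℂ) * s).re := by simpa using mul_pos hr hs
  rw [integrableOn_Ici_iff_integrableOn_Ioi]
  simp only [scaledLaguerre_mul_scaledLaguerre_mul_cexp]
  exact integrable_finsetSum _ fun i _ => integrable_finsetSum _ fun j _ =>
    (integrableOn_pow_mul_cexp_neg _ hc).const_mul _

/-- The factor `(i + j)!` over `i! j!` is the binomial coefficient of `laplaceCoeff`, and the powers
of `r` cancel down to `r⁻¹`. -/
theorem integral_scaledLaguerre_mul_cexp (hr : 0 < r) (hs : 0 < s.re) (k l : ℕ) :
    ∫ x in Set.Ici (0 : ℝ), (((scaledLaguerre r k).eval x : ℝ) : ℂ) *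
      ((scaledLaguerre r l).eval x : ℝ) * Complex.exp (-(r * s) * x) =
        (r : ℂ)⁻¹ * laplaceCoeff s k l := by
  have hc : 0 < ((r : ℂ) * s).re := by simpa using mul_pos hr hs
  have hr0 : (r : ℂ) ≠ 0 := by exact_mod_cast hr.ne'
  have hs0 : s ≠ 0 := by rintro rfl; simp at hs
  have hint := fun n => integrableOn_pow_mul_cexp_neg n hc
  rw [integral_Ici_eq_integral_Ioi, laplaceCoeff, Finset.mul_sum]
  simp only [scaledLaguerre_mul_scaledLaguerre_mul_cexp]
  rw [integral_finsetSum _ fun i _ => integrable_finsetSum _ fun j _ => (hint _).const_mul _]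
  refine Finset.sum_congr rfl fun i _ => ?_
  rw [integral_finsetSum _ fun j _ => (hint _).const_mul _, Finset.mul_sum]
  refine Finset.sum_congr rfl fun j _ => ?_
  rw [integral_const_mul, integral_pow_mul_cexp_neg _ hc,
    ← Nat.add_choose_mul_factorial_mul_factorial i j, Nat.choose_symm_add]
  have hi : (i.factorial : ℂ) ≠ 0 := by exact_mod_cast i.factorial_ne_zero
  have hj : (j.factorial : ℂ) ≠ 0 := by exact_mod_cast j.factorial_ne_zero
  push_cast
  field_simp
  ring

end

/-! ### Andréief's expansion -/

theorem det_mul_det_mul_prod {ι α : Type*} [Fintype ι] [DecidableEq ι]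
    (φ ψ G : ι → α → ℂ) (x : ι → α) :
    (Matrix.of fun j i => φ j (x i)).det * (Matrix.of fun j i => ψ j (x i)).det *
        ∏ i, G i (x i) =
      ∑ σ : Equiv.Perm ι, ∑ τ : Equiv.Perm ι,
        ((Equiv.Perm.sign σ : ℤ) : ℂ) * ((Equiv.Perm.sign τ : ℤ) : ℂ) *
          ∏ i, φ (σ i) (x i) * ψ (τ i) (x i) * G i (x i) := by
  rw [Matrix.det_apply', Matrix.det_apply', Finset.sum_mul_sum, Finset.sum_mul]
  refine Finset.sum_congr rfl fun σ _ => ?_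
  rw [Finset.sum_mul]
  refine Finset.sum_congr rfl fun τ _ => ?_
  simp only [Matrix.of_apply, Finset.prod_mul_distrib]
  ring

theorem perm_eq_of_eq_off {ι : Type*} {σ τ : Equiv.Perm ι} (k : ι) (h : ∀ i, i ≠ k → σ i = τ i) : σ = τ := by
  ext i
  by_cases hi : i = k
  · subst hi
    obtain ⟨j, hj⟩ := τ.surjective (σ i)
    by_cases hji : j = i
    · rw [← hj, hji]
    · rw [← h j hji] at hj
      exact absurd (σ.injective hj) hji
  · exact h i hi

/-- Writes `g (x k)` as a product over all `i` of factors `g` at `i = k` and `1` elsewhere, the form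
that `det_mul_det_mul_prod` accepts. -/
theorem integrable_mul_ite {ι α : Type*} [DecidableEq ι] [MeasurableSpace α] {μ : Measure α}
    {φ ψ : ι → α → ℂ} {g : α → ℂ} (hint : ∀ j k, Integrable (fun x => φ j x * ψ k x) μ)
    (hintg : ∀ j k, Integrable (fun x => φ j x * ψ k x * g x) μ) (k i j l : ι) :
    Integrable (fun x => φ j x * ψ l x * (if i = k then g x else 1)) μ := by
  split_ifs
  · exact hintg j l
  · simpa using hint j l

section Andreief

variable {ι α : Type*} [Fintype ι] [DecidableEq ι] [MeasurableSpace α] {μ : Measure α}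
  [SigmaFinite μ] {φ ψ : ι → α → ℂ}

theorem integrable_det_mul_det_mul_prod {G : ι → α → ℂ}
    (hint : ∀ i j k, Integrable (fun x => φ j x * ψ k x * G i x) μ) :
    Integrable (fun x : ι → α => (Matrix.of fun j i => φ j (x i)).det *
      (Matrix.of fun j i => ψ j (x i)).det * ∏ i, G i (x i)) (Measure.pi fun _ => μ) := by
  simp only [det_mul_det_mul_prod]
  exact integrable_finsetSum _ fun σ _ => integrable_finsetSum _ fun τ _ =>
    (Integrable.fintype_prod fun i => hint i (σ i) (τ i)).const_mul _

theorem integrable_det_mul_det (hint : ∀ j k, Integrable (fun x => φ j x * ψ k x) μ) :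
    Integrable (fun x : ι → α => (Matrix.of fun j i => φ j (x i)).det *
      (Matrix.of fun j i => ψ j (x i)).det) (Measure.pi fun _ => μ) := by
  simpa using integrable_det_mul_det_mul_prod (μ := μ) (φ := φ) (ψ := ψ) (G := fun _ _ => 1)
    (by simpa using fun _ j k => hint j k)

theorem integral_det_mul_det_mul_prod {G : ι → α → ℂ}
    (hint : ∀ i j k, Integrable (fun x => φ j x * ψ k x * G i x) μ) :
    ∫ x : ι → α, (Matrix.of fun j i => φ j (x i)).det * (Matrix.of fun j i => ψ j (x i)).det *
        ∏ i, G i (x i) ∂(Measure.pi fun _ => μ) =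
      ∑ σ : Equiv.Perm ι, ∑ τ : Equiv.Perm ι,
        ((Equiv.Perm.sign σ : ℤ) : ℂ) * ((Equiv.Perm.sign τ : ℤ) : ℂ) *
          ∏ i, ∫ x, φ (σ i) x * ψ (τ i) x * G i x ∂μ := by
  have h := fun σ τ : Equiv.Perm ι => (Integrable.fintype_prod (μ := fun _ => μ)
    fun i => hint i (σ i) (τ i)).const_mul
      (((Equiv.Perm.sign σ : ℤ) : ℂ) * ((Equiv.Perm.sign τ : ℤ) : ℂ))
  simp only [det_mul_det_mul_prod]
  rw [integral_finsetSum _ fun σ _ => integrable_finsetSum _ fun τ _ => h σ τ]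
  refine Finset.sum_congr rfl fun σ _ => ?_
  rw [integral_finsetSum _ fun τ _ => h σ τ]
  refine Finset.sum_congr rfl fun τ _ => ?_
  rw [integral_const_mul,
    integral_fintype_prod_eq_prod (f := fun i x => φ (σ i) x * ψ (τ i) x * G i x)]

variable {c : ℂ}

/-- Biorthogonality kills every pair with `σ ≠ τ`; each diagonal pair has sign `1` and contributes
`c` per variable. -/
theorem integral_det_mul_det_of_biorthogonal
    (hint : ∀ j k, Integrable (fun x => φ j x * ψ k x) μ)
    (horth : ∀ j k, ∫ x, φ j x * ψ k x ∂μ = if j = k then c else 0) :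
    ∫ x : ι → α, (Matrix.of fun j i => φ j (x i)).det * (Matrix.of fun j i => ψ j (x i)).det
        ∂(Measure.pi fun _ => μ) =
      (Fintype.card ι).factorial * c ^ Fintype.card ι := by
  have h := integral_det_mul_det_mul_prod (μ := μ) (φ := φ) (ψ := ψ) (G := fun _ _ => 1)
    (by simpa using fun _ j k => hint j k)
  simp only [Finset.prod_const_one, mul_one] at h
  rw [h, Finset.sum_congr rfl fun σ _ => Finset.sum_eq_single σ ?_ (by simp)]
  · simp [horth, ← Int.cast_mul, ← Units.val_mul, Fintype.card_perm]
  · intro τ _ hτ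
    obtain ⟨i, hi⟩ : ∃ i, σ i ≠ τ i := by
      by_contra! hcon
      exact hτ (Equiv.ext hcon).symm
    rw [Finset.prod_eq_zero (Finset.mem_univ i), mul_zero]
    rw [horth, if_neg hi]

variable {g : α → ℂ}

theorem integrable_det_mul_det_mul_sum
    (hint : ∀ j k, Integrable (fun x => φ j x * ψ k x) μ)
    (hintg : ∀ j k, Integrable (fun x => φ j x * ψ k x * g x) μ) :
    Integrable (fun x : ι → α => (Matrix.of fun j i => φ j (x i)).det *
      (Matrix.of fun j i => ψ j (x i)).det * ∑ i, g (x i)) (Measure.pi fun _ => μ) := by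
  simp only [Finset.mul_sum]
  refine integrable_finsetSum _ fun k _ => ?_
  simpa using integrable_det_mul_det_mul_prod (integrable_mul_ite hint hintg k)

theorem integral_det_mul_det_mul_sum_of_biorthogonal
    (hint : ∀ j k, Integrable (fun x => φ j x * ψ k x) μ)
    (hintg : ∀ j k, Integrable (fun x => φ j x * ψ k x * g x) μ)
    (horth : ∀ j k, ∫ x, φ j x * ψ k x ∂μ = if j = k then c else 0) :
    ∫ x : ι → α, (Matrix.of fun j i => φ j (x i)).det * (Matrix.of fun j i => ψ j (x i)).det *
        ∑ i, g (x i) ∂(Measure.pi fun _ => μ) =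
      (Fintype.card ι).factorial * (c ^ (Fintype.card ι - 1) *
        ∑ j, ∫ x, φ j x * ψ j x * g x ∂μ) := by
  have hone : ∀ k : ι, ∫ x : ι → α, (Matrix.of fun j i => φ j (x i)).det *
      (Matrix.of fun j i => ψ j (x i)).det * g (x k) ∂(Measure.pi fun _ => μ) =
        ∑ σ : Equiv.Perm ι, c ^ (Fintype.card ι - 1) *
          ∫ x, φ (σ k) x * ψ (σ k) x * g x ∂μ := by
    intro k
    have h := integral_det_mul_det_mul_prod (integrable_mul_ite hint hintg k)
    simp only [Finset.prod_ite_eq', Finset.mem_univ, if_true] at h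
    rw [h]
    refine Finset.sum_congr rfl fun σ _ => ?_
    rw [Finset.sum_eq_single σ ?_ (by simp)]
    · rw [← Finset.mul_prod_erase _ _ (Finset.mem_univ k),
        Finset.prod_congr rfl (g := fun _ => c) fun i hi => by
          simp [Finset.ne_of_mem_erase hi, horth]]
      simp [← Int.cast_mul, ← Units.val_mul, Finset.card_erase_of_mem, mul_comm]
    -- Two distinct permutations differ at some point other than `k`, where the factor is still a
    -- plain orthogonality integral.
    · intro τ _ hτ
      obtain ⟨i, hik, hi⟩ : ∃ i, i ≠ k ∧ σ i ≠ τ i := by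
        by_contra! hcon
        exact hτ (perm_eq_of_eq_off k hcon).symm
      rw [Finset.prod_eq_zero (Finset.mem_univ i), mul_zero]
      simp [hik, horth, hi]
  simp only [Finset.mul_sum (Finset.univ : Finset ι)]
  rw [integral_finsetSum]
  · simp only [hone]
    -- For fixed `σ`, the sum over `k` is reindexed by `j = σ k` and no longer depends on `σ`,
    -- whence the factorial.
    rw [Finset.sum_comm, Finset.sum_congr rfl fun σ _ => Equiv.sum_comp σ fun j =>
      c ^ (Fintype.card ι - 1) * ∫ x, φ j x * ψ j x * g x ∂μ]
    simp [Fintype.card_perm, Finset.mul_sum]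
  · intro k _
    simpa using integrable_det_mul_det_mul_prod (integrable_mul_ite hint hintg k)

end Andreief

/-! ### The Laguerre weight as a product of determinants -/

theorem restrict_orthant (N : ℕ) :
    (volume : Measure (Fin N → ℝ)).restrict (orthant N) =
      Measure.pi fun _ => volume.restrict (Set.Ici 0) := by
  have h : orthant N = Set.univ.pi fun _ => Set.Ici 0 := by
    ext x
    simp [orthant, Pi.le_def]
  rw [h, volume_pi, Measure.restrict_pi_pi]

theorem vandermonde_sq {N : ℕ} (lam : Fin N → ℝ) :
    vandermonde lam ^ 2 = (Matrix.vandermonde lam).det ^ 2 := by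
  rw [vandermonde, Matrix.det_vandermonde]
  simp only [← Finset.prod_pow]
  exact Finset.prod_congr rfl fun i _ => Finset.prod_congr rfl fun j _ => by ring

/-- The degree bound makes the change of basis from monomials triangular, with the leading
coefficients on its diagonal. -/
theorem det_eval_scaledLaguerre {N : ℕ} (r : ℝ) (lam : Fin N → ℝ) :
    (Matrix.of fun j i : Fin N => (scaledLaguerre r j).eval (lam i)).det =
      (Matrix.vandermonde lam).det * ∏ j : Fin N, (scaledLaguerre r j).coeff j := by
  have hdeg : ∀ j : Fin N, (scaledLaguerre r j).natDegree ≤ j := fun j =>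
    natDegree_scaledLaguerre_le r j
  rw [← Matrix.det_transpose]
  have h := Matrix.eval_matrixOfPolynomials_eq_vandermonde_mul_matrixOfPolynomials lam
    (fun j : Fin N => scaledLaguerre r j) hdeg
  calc _ = _ := congrArg Matrix.det h
    _ = _ := by
      rw [Matrix.det_mul, Matrix.det_of_isUpperTriangular
        (Matrix.matrixOfPolynomials_blockTriangular _ hdeg)]
      simp

/-- The Vandermonde determinant times `leadingProd N` is the determinant of the Laguerre
polynomials. -/
noncomputable def leadingProd (N : ℕ) : ℝ := ∏ j : Fin N, (scaledLaguerre N j).coeff j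

/-- The Laguerre polynomials `L_j (N x)`, with complex values. -/
noncomputable def laguerreFun (N : ℕ) (j : Fin N) (x : ℝ) : ℂ :=
  ((scaledLaguerre N j).eval x : ℝ)

/-- The Laguerre functions `L_j (N x) e^{-N x}`, dual to `laguerreFun`. -/
noncomputable def laguerreDual (N : ℕ) (j : Fin N) (x : ℝ) : ℂ :=
  ((scaledLaguerre N j).eval x : ℝ) * Complex.exp (-((N : ℝ) * (1 : ℂ)) * x)

theorem ofReal_weight_eq {N : ℕ} (hN : (N : ℝ) ≠ 0) (lam : Fin N → ℝ) :
    (weight N lam : ℂ) = ((leadingProd N ^ 2 : ℝ) : ℂ)⁻¹ *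
      ((Matrix.of fun j i : Fin N => laguerreFun N j (lam i)).det *
        (Matrix.of fun j i : Fin N => laguerreDual N j (lam i)).det) := by
  have hL : leadingProd N ≠ 0 :=
    Finset.prod_ne_zero_iff.2 fun j _ => coeff_scaledLaguerre_ne_zero hN j
  have h1 : (Matrix.of fun j i : Fin N => laguerreFun N j (lam i)).det =
      (((Matrix.vandermonde lam).det * leadingProd N : ℝ) : ℂ) := by
    rw [leadingProd, ← det_eval_scaledLaguerre]
    exact (RingHom.map_det Complex.ofRealHom _).symm
  have h2 : (Matrix.of fun j i : Fin N => laguerreDual N j (lam i)).det = (Real.exp (-(N : ℝ) * ∑ i, lam i) : ℂ) *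
        (Matrix.of fun j i : Fin N => laguerreFun N j (lam i)).det := by
    -- The exponential splits over the variables, so each factor scales one column of the second
    -- determinant.
    have h3 := Matrix.det_mul_row (fun i : Fin N => Complex.exp (-((N : ℝ) * 1) * lam i))
      (Matrix.of fun j i : Fin N => laguerreFun N j (lam i))
    simp only [Matrix.of_apply, mul_comm (Complex.exp _)] at h3
    refine h3.trans ?_
    rw [ ← Complex.exp_sum, ← Finset.mul_sum]
    simp [mul_comm]
  rw [h2, h1, weight, vandermonde_sq]
  have hL' : (leadingProd N : ℂ) ≠ 0 := by exact_mod_cast hL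
  push_cast
  field_simp

/-! ### Normalisation and mean of the trace -/

section

variable {N : ℕ} {u : ℂ}

theorem laguerreFun_mul_laguerreDual (j k : Fin N) (x : ℝ) :
    laguerreFun N j x * laguerreDual N k x = (((scaledLaguerre N j).eval x : ℝ) : ℂ) *
      ((scaledLaguerre N k).eval x : ℝ) * Complex.exp (-((N : ℝ) * (1 : ℂ)) * x) := by
  rw [laguerreFun, laguerreDual, mul_assoc]

theorem laguerreFun_mul_laguerreDual_mul_exp (u : ℂ) (j k : Fin N) (x : ℝ) :
    laguerreFun N j x * laguerreDual N k x * Complex.exp ((N : ℂ) * u * x) =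
      (((scaledLaguerre N j).eval x : ℝ) : ℂ) * ((scaledLaguerre N k).eval x : ℝ) *
        Complex.exp (-((N : ℝ) * (1 - u)) * x) := by
  rw [laguerreFun_mul_laguerreDual, mul_assoc, ← Complex.exp_add]
  congr 2
  push_cast
  ring

theorem integrable_laguerreFun_mul_laguerreDual (hN : 1 ≤ N) (j k : Fin N) :
    Integrable (fun x => laguerreFun N j x * laguerreDual N k x)
      (volume.restrict (Set.Ici 0)) := by
  simp only [laguerreFun_mul_laguerreDual]
  exact integrableOn_scaledLaguerre_mul_cexp (by exact_mod_cast hN) (by simp) j k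

theorem integral_laguerreFun_mul_laguerreDual (hN : 1 ≤ N) (j k : Fin N) :
    ∫ x in Set.Ici (0 : ℝ), laguerreFun N j x * laguerreDual N k x =
      if j = k then (N : ℂ)⁻¹ else 0 := by
  simp only [laguerreFun_mul_laguerreDual]
  rw [integral_scaledLaguerre_mul_cexp (by exact_mod_cast hN) (by simp), laplaceCoeff_one]
  simp [Fin.ext_iff]

theorem integrable_laguerreFun_mul_laguerreDual_mul_exp (hN : 1 ≤ N) (hu : u.re < 1)
    (j k : Fin N) :
    Integrable (fun x : ℝ => laguerreFun N j x * laguerreDual N k x *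
      Complex.exp ((N : ℂ) * u * x)) (volume.restrict (Set.Ici 0)) := by
  simp only [laguerreFun_mul_laguerreDual_mul_exp]
  exact integrableOn_scaledLaguerre_mul_cexp (by exact_mod_cast hN) (by simpa using hu) j k

theorem integrableOn_weight (hN : 1 ≤ N) : IntegrableOn (weight N) (orthant N) := by
  have hN0 : (N : ℝ) ≠ 0 := by positivity
  have h : Integrable (fun lam => (weight N lam : ℂ)) (volume.restrict (orthant N)) := by
    rw [restrict_orthant]
    simp only [ofReal_weight_eq hN0]
    refine Integrable.const_mul ?_ _
    exact integrable_det_mul_det (integrable_laguerreFun_mul_laguerreDual hN)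
  exact h.re

theorem ofReal_partitionFunction (hN : 1 ≤ N) :
    (partitionFunction N : ℂ) =
      ((leadingProd N ^ 2 : ℝ) : ℂ)⁻¹ * (N.factorial * (N : ℂ)⁻¹ ^ N) := by
  have hN0 : (N : ℝ) ≠ 0 := by positivity
  rw [partitionFunction, ← integral_complex_ofReal, restrict_orthant]
  simp only [ofReal_weight_eq hN0]
  rw [integral_const_mul, integral_det_mul_det_of_biorthogonal (integrable_laguerreFun_mul_laguerreDual hN)
    (integral_laguerreFun_mul_laguerreDual hN), Fintype.card_fin]

theorem partitionFunction_pos (hN : 1 ≤ N) : 0 < partitionFunction N := by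
  have h : partitionFunction N = (leadingProd N ^ 2)⁻¹ * (N.factorial * (N : ℝ)⁻¹ ^ N) := by
    apply Complex.ofReal_injective
    rw [ofReal_partitionFunction hN]
    push_cast
    rfl
  have hL : leadingProd N ≠ 0 :=
    Finset.prod_ne_zero_iff.2 fun j _ => coeff_scaledLaguerre_ne_zero (by positivity) j
  have := N.factorial_pos
  rw [h]
  positivity

theorem integrableOn_weight_mul_traceExp (hN : 1 ≤ N) (hu : u.re < 1) :
    IntegrableOn (fun lam => (weight N lam : ℂ) * traceExp ((N : ℂ) * u) lam) (orthant N) := by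
  have hN0 : (N : ℝ) ≠ 0 := by positivity
  rw [IntegrableOn, restrict_orthant]
  simp only [ofReal_weight_eq hN0, mul_assoc ((_ : ℂ)⁻¹)]
  exact (integrable_det_mul_det_mul_sum (integrable_laguerreFun_mul_laguerreDual hN)
    (integrable_laguerreFun_mul_laguerreDual_mul_exp hN hu)).const_mul _

theorem mean_traceExp (hN : 1 ≤ N) (hu : u.re < 1) :
    mean N (traceExp ((N : ℂ) * u)) = ∑ k ∈ Finset.range N, laplaceCoeff (1 - u) k k := by
  have hN0 : (N : ℝ) ≠ 0 := by positivity
  have hZ : (partitionFunction N : ℂ) ≠ 0 := by exact_mod_cast (partitionFunction_pos hN).ne'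
  have key : ∫ lam in orthant N, (weight N lam : ℂ) * traceExp ((N : ℂ) * u) lam =
      partitionFunction N * ∑ k ∈ Finset.range N, laplaceCoeff (1 - u) k k := by
    rw [restrict_orthant]
    simp only [ofReal_weight_eq hN0, mul_assoc ((_ : ℂ)⁻¹), traceExp]
    rw [integral_const_mul, integral_det_mul_det_mul_sum_of_biorthogonal
      (integrable_laguerreFun_mul_laguerreDual hN) (integrable_laguerreFun_mul_laguerreDual_mul_exp hN hu)
      (integral_laguerreFun_mul_laguerreDual hN) (g := fun x : ℝ => Complex.exp ((N : ℂ) * u * x)),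
      ofReal_partitionFunction hN, Fintype.card_fin]
    simp only [laguerreFun_mul_laguerreDual_mul_exp]
    have hlap := fun j => integral_scaledLaguerre_mul_cexp (r := N) (s := 1 - u)
      (by exact_mod_cast hN) (by simpa using hu) j j
    simp only [hlap]
    rw [← Finset.mul_sum, Fin.sum_univ_eq_sum_range fun k => laplaceCoeff (1 - u) k k]
    -- With `N = n + 1`, the `N - 1` orthogonality factors `N⁻¹` and the one from the Laplace
    -- transform make up the `N⁻¹ ^ N` of the partition function.
    obtain ⟨n, rfl⟩ := Nat.exists_eq_add_of_le' hN
    simp only [Nat.add_sub_cancel, pow_succ, Complex.ofReal_natCast]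
    ring
  rw [mean, key, inv_mul_cancel_left₀ hZ]

end

end Laguerre

theorem mainTheorem3 (N : ℕ) (hN : 1 ≤ N) (u : ℂ) (hu : u ≠ 0) (hu1 : u.re < 1) :
    -- the mean is well defined: finite positive normalisation, absolutely convergent integral
    IntegrableOn (Laguerre.weight N) (Laguerre.orthant N) ∧
    0 < Laguerre.partitionFunction N ∧
    IntegrableOn
      (fun lam => (Laguerre.weight N lam : ℂ) * Laguerre.traceExp ((N : ℂ) * u) lam)
      (Laguerre.orthant N) ∧
    -- the two contour integral representations, for every admissible contour
    (∀ (a : ℂ) (γ : Path a a), Laguerre.IsContour u γ →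
      Laguerre.mean N (Laguerre.traceExp ((N : ℂ) * u)) =
          1 / u * ((2 * Real.pi * Complex.I)⁻¹ * Laguerre.contourIntegral γ
            (fun z => (1 - z) ^ N / (1 - z - u) ^ N * ((z + u) ^ N / z ^ N))) ∧
      Laguerre.mean N (Laguerre.traceExp ((N : ℂ) * u)) =
          1 / u * ((2 * Real.pi * Complex.I)⁻¹ * Laguerre.contourIntegral γ
            (fun z => (1 + 1 / (z + u - 1)) ^ N * (1 - 1 / z) ^ N))) ∧
    Laguerre.mean N (Laguerre.traceExp ((N : ℂ) * u)) = 1 / u * Laguerre.f N N u := by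
  have hs : 1 - u ≠ 0 := fun h => by
    rw [sub_eq_zero] at h
    simp [← h] at hu1
  refine ⟨Laguerre.integrableOn_weight hN, Laguerre.partitionFunction_pos hN,
    Laguerre.integrableOn_weight_mul_traceExp hN hu1, fun a γ hγ => ?_, ?_⟩
  · rw [Laguerre.mean_traceExp hN hu1, hγ.isResidueFunctional.eq_integrand hs,
      hγ.isResidueFunctional.eq_quotient_integrand hs]
    constructor <;> field_simp
  · have hs' := norm_pos_iff.2 hs
    rw [Laguerre.mean_traceExp hN hu1, Laguerre.f,
      (Laguerre.isResidueFunctional_circleIntegral (half_pos hs')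
        (half_lt_self hs')).eq_integrand hs]
    field_simp
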